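/- **Setting.** Let $D=\{z\in\mathbb C:|z|<R\}$ with $R>0$, $D^\times=D\setminus\{0\}$, and write $z=re^{i\theta}$. All objects are written in a fixed unitary frame of a Hermitian rank-2 bundle. A configuration over an open set $U$ is a pair $(A,\Phi)$ with $A$ a smooth $\mathfrak{su}(2)$-valued 1-form and $\Phi=\varphi\,dz$ with $\varphi$ smooth and trace-free on $U$. A complex gauge transformation over $U$ is a smooth map $g:U\to \mathrm{SL}(2,\mathbb C)$; it acts by $(A,\Phi)^g=(A^g,g^{-1}\Phi g)$, where $$d_{A^g}=g^{-1}\circ\bar\partial_A\circ g+g^*\circ\partial_A\circ (g^*)^{-1}.$$ Two configurations are complex gauge equivalent over $U$ if some such $g$ carries one to the other. Let $\psi:(0,\infty)\to\mathbb R$ be the monotonically decreasing solution of $(\rho\partial_\rho)^2\psi=\tfrac12\rho^2\sinh 2\psi$ with $\rho^{-1/3}e^{-\psi(\rho)}\to a_0$ for some $a_0>0$ as $\rho\searrow0$ and $\psi(\rho)=O(\rho^{-1/2}e^{-\rho})$ as $\rho\to\infty$. For $0<t<\infty$ put $h_t(r)=\psi(\tfrac83tr^{3/2})$, $f_t(r)=\tfrac18+\tfrac14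 r\partial_rh_t(r)$, and let $$A_t^{\rm fid}=f_t(r)\begin{pmatrix}1&0\\0&-1\end{pmatrix}\Big(\frac{dz}z-\frac{d\bar z}{\bar z}\Big),\qquad \Phi_t^{\rm fid}=\begin{pmatrix}0&r^{1/2}e^{h_t(r)}\\ r^{1/2}e^{i\theta}e^{-h_t(r)}&0\end{pmatrix}dz,$$ extended to $z=0$ by continuity. Let also $$A_\infty^{\rm fid}=\frac18\begin{pmatrix}1&0\\0&-1\end{pmatrix}\Big(\frac{dz}z-\frac{d\bar z}{\bar z}\Big),\quad \Phi_\infty^{\rm fid}=\begin{pmatrix}0&\sqrt{|z|}\\ z/\sqrt{|z|}&0\end{pmatrix}dz,\quad A_0=0,\quad \Phi_0=\begin{pmatrix}0&1\\z&0\end{pmatrix}dz.$$ **Proposition.** 1. For every $0<t<\infty$, with $u_t=-\tfrac14\log r-\tfrac12h_t(r)$, the map $g_t=\exp(\mathrm{diag}(u_t,-u_t))$, extended to $z=0$ by continuity, is a complex gauge transformation over $D$, the pairs $(A_0,\Phi_0)$ and $(A_t^{\rm fid},\Phi_t^{\rm fid})$ are configurations over $D$, and $(A_0,\Phi_0)^{g_t}=(A_t^{\rm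 fid},\Phi_t^{\rm fid})$ over $D$. In particular, $(A_s^{\rm fid},\Phi_s^{\rm fid})$ and $(A_t^{\rm fid},\Phi_t^{\rm fid})$ are complex gauge equivalent over $D$ for all $0<s,t<\infty$. 2. The map $g_\infty=\mathrm{diag}(|z|^{-1/4},|z|^{1/4})$ is a complex gauge transformation over $D^\times$, the pairs $(A_0,\Phi_0)$ and $(A_\infty^{\rm fid},\Phi_\infty^{\rm fid})$ are configurations over $D^\times$, and $(A_0,\Phi_0)^{g_\infty}=(A_\infty^{\rm fid},\Phi_\infty^{\rm fid})$ over $D^\times$. -/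

import Mathlib

open Filter Topology
open scoped ContDiff Matrix

noncomputable section

namespace Fiducial

/-! Everything is written in a fixed unitary frame of a rank two Hermitian bundle over an open
subset `U` of `ℂ`. A matrix valued one-form is given by its coefficients with respect to
`dz` and `d z̄`. -/

/-- Complex `2 × 2` matrices. -/
abbrev M2 := Matrix (Fin 2) (Fin 2) ℂ

/-- A pair `(A, Φ)` with `A = Az dz + Azbar d z̄` and `Φ = phi dz`. -/
@[ext]
structure Pair where
  Az : ℂ → M2
  Azbar : ℂ → M2
  phi : ℂ → M2

/-- Smoothness on `U` of a matrix valued function. -/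
def SmoothOn (U : Set ℂ) (m : ℂ → M2) : Prop :=
  ∀ i j, ContDiffOn ℝ ∞ (fun z => m z i j) U

/-- `(A, Φ)` is a smooth configuration over `U`: `A` is a smooth connection form with values in
`su(2)` (skew-Hermitian, i.e. the `d z̄`-coefficient is minus the adjoint of the
`dz`-coefficient, and trace-free) and `Φ` is a smooth trace-free `(1,0)`-form. -/
structure IsConfiguration (U : Set ℂ) (p : Pair) : Prop where
  smooth_Az : SmoothOn U p.Az
  smooth_Azbar : SmoothOn U p.Azbar
  smooth_phi : SmoothOn U p.phi
  unitary : ∀ z ∈ U, p.Azbar z = -(p.Az z)ᴴ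
  trace_Az : ∀ z ∈ U, (p.Az z).trace = 0
  trace_phi : ∀ z ∈ U, (p.phi z).trace = 0

/-- The coefficient `∂m/∂z = (∂ₓ m - i ∂_y m) / 2`, entrywise. -/
def dz (m : ℂ → M2) (z : ℂ) : M2 :=
  Matrix.of fun i j =>
    (fderiv ℝ (fun w => m w i j) z 1 - Complex.I * fderiv ℝ (fun w => m w i j) z Complex.I) / 2

/-- The coefficient `∂m/∂z̄ = (∂ₓ m + i ∂_y m) / 2`, entrywise. -/
def dzbar (m : ℂ → M2) (z : ℂ) : M2 :=
  Matrix.of fun i j =>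
    (fderiv ℝ (fun w => m w i j) z 1 + Complex.I * fderiv ℝ (fun w => m w i j) z Complex.I) / 2

/-- Complex gauge transformations over `U`: smooth maps `U → SL(2, ℂ)`. -/
structure IsComplexGauge (U : Set ℂ) (g : ℂ → M2) : Prop where
  smooth : SmoothOn U g
  det_eq_one : ∀ z ∈ U, (g z).det = 1

/-- The complex gauge action `(A, Φ)^g = (A^g, g⁻¹ Φ g)`, where
`d_{A^g} = g⁻¹ ∘ ∂̄_A ∘ g + g^* ∘ ∂_A ∘ (g^*)⁻¹`. -/
def Pair.gauge (p : Pair) (g : ℂ → M2) : Pair where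
  Az z := (g z)ᴴ * p.Az z * ((g z)ᴴ)⁻¹ + (g z)ᴴ * dz (fun w => ((g w)ᴴ)⁻¹) z
  Azbar z := (g z)⁻¹ * p.Azbar z * g z + (g z)⁻¹ * dzbar g z
  phi z := (g z)⁻¹ * p.phi z * g z

/-- `p` and `q` coincide over `U`. -/
def Pair.EqOn (U : Set ℂ) (p q : Pair) : Prop :=
  Set.EqOn p.Az q.Az U ∧ Set.EqOn p.Azbar q.Azbar U ∧ Set.EqOn p.phi q.phi U

/-- `p` and `q` are configurations over `U`, `g` is a complex gauge transformation over `U`,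
and `p^g = q` over `U`. -/
structure GaugeEquivalentVia (U : Set ℂ) (g : ℂ → M2) (p q : Pair) : Prop where
  left : IsConfiguration U p
  right : IsConfiguration U q
  isGauge : IsComplexGauge U g
  eqOn : Pair.EqOn U (p.gauge g) q

/-- Complex gauge equivalence over `U`. -/
def GaugeEquivalent (U : Set ℂ) (p q : Pair) : Prop :=
  ∃ g, GaugeEquivalentVia U g p q

/-- The pair `A₀ = 0`, `Φ₀ = [[0, 1], [z, 0]] dz`. -/
def basePair : Pair where
  Az _ := 0
  Azbar _ := 0
  phi z := !![0, 1; z, 0]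

/-- The Painlevé function `ψ` on `(0, ∞)`: the solution of
`(ρ d/dρ)² ψ = ½ ρ² sinh (2ψ)` with `e^{-ψ} ~ a₀ ρ^{1/3}`, `a₀ > 0`, as `ρ → 0`, with the decay
rate `ρ^{-1/2} e^{-ρ}` of the Macdonald function `K₀` as `ρ → ∞`, and monotonically decreasing.
Only the leading term at `0` is prescribed; the higher terms of the expansion of `ψ` are
consequences of the equation. -/
structure IsPainleveFunction (ψ : ℝ → ℝ) : Prop where
  contDiffOn : ContDiffOn ℝ 2 ψ (Set.Ioi 0)
  equation : ∀ ρ, 0 < ρ →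
    ρ * deriv (fun s => s * deriv ψ s) ρ = 1 / 2 * ρ ^ 2 * Real.sinh (2 * ψ ρ)
  at_zero : ∃ a₀ : ℝ, 0 < a₀ ∧
    Tendsto (fun ρ : ℝ => ρ ^ (-(1 / 3) : ℝ) * Real.exp (-ψ ρ)) (𝓝[>] 0) (𝓝 a₀)
  at_infinity : ψ =O[atTop] fun ρ : ℝ => ρ ^ (-(1 / 2) : ℝ) * Real.exp (-ρ)
  antitoneOn : AntitoneOn ψ (Set.Ioi 0)

/-- `h_t(r) = ψ((8/3) t r^{3/2})`. -/
def h (ψ : ℝ → ℝ) (t r : ℝ) : ℝ := ψ (8 / 3 * t * r ^ (3 / 2 : ℝ))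

/-- `f_t(r) = 1/8 + (1/4) r ∂_r h_t(r)`. -/
def f (ψ : ℝ → ℝ) (t r : ℝ) : ℝ := 1 / 8 + 1 / 4 * r * deriv (h ψ t) r

/-- `u_t(r) = -(1/4) log r - (1/2) h_t(r)`. -/
def u (ψ : ℝ → ℝ) (t r : ℝ) : ℝ := -(1 / 4) * Real.log r - 1 / 2 * h ψ t r

/-- A function given by a formula on `ℂ \ {0}`, extended to `0` by continuity. -/
def extendToZero (m : ℂ → M2) : ℂ → M2 :=
  Function.update m 0 (limUnder (𝓝[≠] 0) m)

/-- The fiducial solution `(A_t, Φ_t)`: for `z = r e^{iθ} ≠ 0`,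
`A_t = f_t(r) diag(1, -1) (dz/z - d z̄/z̄)` and
`Φ_t = [[0, r^{1/2} e^{h_t(r)}], [r^{1/2} e^{iθ} e^{-h_t(r)}, 0]] dz`, with `e^{iθ} = z/|z|`;
at `z = 0` the coefficients are extended by continuity. -/
def fiducial (ψ : ℝ → ℝ) (t : ℝ) : Pair where
  Az := extendToZero fun z => ((f ψ t ‖z‖ : ℂ) / z) • !![1, 0; 0, -1]
  Azbar := extendToZero fun z => (-((f ψ t ‖z‖ : ℂ) / starRingEnd ℂ z)) • !![1, 0; 0, -1]
  phi := extendToZero fun z =>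
    !![0, ((√‖z‖ * Real.exp (h ψ t ‖z‖) : ℝ) : ℂ);
       ((√‖z‖ : ℝ) : ℂ) * (z / (‖z‖ : ℂ)) * ((Real.exp (-h ψ t ‖z‖) : ℝ) : ℂ), 0]

/-- The limiting fiducial solution (meaningful for `z ≠ 0`):
`A_∞ = (1/8) diag(1, -1) (dz/z - d z̄/z̄)`, `Φ_∞ = [[0, √|z|], [z/√|z|, 0]] dz`. -/
def limitingFiducial : Pair where
  Az z := (1 / 8 / z) • !![1, 0; 0, -1]
  Azbar z := (-(1 / 8 / starRingEnd ℂ z)) • !![1, 0; 0, -1]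
  phi z := !![0, ((√‖z‖ : ℝ) : ℂ); z / ((√‖z‖ : ℝ) : ℂ), 0]

/-- The gauge transformation `exp(diag(u_t, -u_t))`, extended to `0` by continuity. -/
def fiducialGauge (ψ : ℝ → ℝ) (t : ℝ) : ℂ → M2 :=
  extendToZero fun z =>
    !![((Real.exp (u ψ t ‖z‖) : ℝ) : ℂ), 0; 0, ((Real.exp (-u ψ t ‖z‖) : ℝ) : ℂ)]

/-- The singular gauge transformation `g_∞ = diag(|z|^{-1/4}, |z|^{1/4})`. -/
def limitingGauge (z : ℂ) : M2 :=
  !![((‖z‖ ^ (-(1 / 4) : ℝ) : ℝ) : ℂ), 0; 0, ((‖z‖ ^ (1 / 4 : ℝ) : ℝ) : ℂ)]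

end Fiducial

end

noncomputable section

namespace Fiducial

universe v

/-! Real diagonal gauges act additively: `exp(diag(v, -v))` carries `expPair w` to `expPair (w +
v)`, and the base pair is `expPair 0` (`gaugeEquivalentVia_expGauge`). Away from `0` the fiducial
pair is `expPair` of `u_t(|z|)`, so the only analytic point is that `u_t(|z|)` extends smoothly
across `z = 0`.

In the variable `s = |z|²` the Painlevé equation becomes `(s U')' = (t²/2)(s e^{4U} - e^{-4U})`,
whose right side is smooth in `(s, U)` (`hasDerivAt_uSqFlux`). The asymptotics of `ψ` cancel the
logarithm in `u_t`, so `U` has a finite limit at `0` (`exists_tendsto_uSq`). This excludes the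
logarithmic solution, and a bootstrap on radial averages gives smoothness on the plane
(`exists_smooth_extension`). The limiting gauge is the same computation with `v = -(1/4) log |z|`,
smooth only off `0`. -/

/-! ### Smooth dependence of integrals on parameters -/

theorem hasFDerivAt_intervalIntegral_of_contDiff {E F : Type v} [NormedAddCommGroup E]
    [NormedSpace ℝ E] [ProperSpace E] [NormedAddCommGroup F] [NormedSpace ℝ F] {k : E × ℝ → F}
    (hk : ContDiff ℝ 1 k) (a b : ℝ) (x : E) :
    HasFDerivAt (fun x => ∫ t in a..b, k (x, t))
      (∫ t in a..b, (fderiv ℝ k (x, t)).comp (ContinuousLinearMap.inl ℝ E ℝ)) x := by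
  have hk' : Continuous fun p => (fderiv ℝ k p).comp (ContinuousLinearMap.inl ℝ E ℝ) :=
    (hk.continuous_fderiv one_ne_zero).clm_comp continuous_const
  -- Compactness of the closed unit ball times the interval yields a constant dominating function.
  obtain ⟨C, hC⟩ := ((isCompact_closedBall x 1).prod
    (isCompact_uIcc (a := a) (b := b))).exists_bound_of_continuousOn hk'.continuousOn
  refine intervalIntegral.hasFDerivAt_integral_of_dominated_of_fderiv_le
    (F := fun x t => k (x, t))
    (F' := fun x t => (fderiv ℝ k (x, t)).comp (ContinuousLinearMap.inl ℝ E ℝ))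
    (bound := fun _ => C) (Metric.closedBall_mem_nhds x one_pos) ?_ ?_ ?_ ?_ ?_ ?_
  · exact .of_forall fun y => (hk.continuous.comp (by fun_prop)).aestronglyMeasurable
  · exact (hk.continuous.comp (by fun_prop)).intervalIntegrable _ _
  · exact (hk'.comp (Continuous.prodMk_right x)).aestronglyMeasurable
  · exact .of_forall fun t ht y hy => hC (y, t) ⟨hy, Set.uIoc_subset_uIcc ht⟩
  · exact intervalIntegrable_const
  · refine .of_forall fun t _ y _ => ?_
    exact ((hk.differentiable one_ne_zero) (y, t)).hasFDerivAt.comp y (hasFDerivAt_prodMk_left y t)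

/-- The induction varies `F`, since the derivative takes values in `E →L[ℝ] F`; `E` and `F` share a
universe so that this space is again admissible. -/
theorem contDiff_intervalIntegral {E : Type v} [NormedAddCommGroup E]
    [NormedSpace ℝ E] [ProperSpace E] (a b : ℝ) (n : ℕ) :
    ∀ {F : Type v} [NormedAddCommGroup F] [NormedSpace ℝ F] {k : E × ℝ → F},
      ContDiff ℝ n k → ContDiff ℝ n fun x => ∫ t in a..b, k (x, t) := by
  induction n with
  | zero =>
    intro F _ _ k hk
    rw [Nat.cast_zero, contDiff_zero] at hk ⊢
    exact intervalIntegral.continuous_parametric_intervalIntegral_of_continuous'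
      (f := fun x t => k (x, t)) hk a b
  | succ n ih =>
    intro F _ _ k hk
    have hd := hasFDerivAt_intervalIntegral_of_contDiff (hk.of_le (by norm_cast; lia)) a b
    rw [Nat.cast_succ] at hk ⊢
    refine contDiff_succ_iff_fderiv.2 ⟨fun x => (hd x).differentiableAt, by simp, ?_⟩
    rw [show (fderiv ℝ fun x => ∫ t in a..b, k (x, t)) = _ from funext fun x => (hd x).fderiv]
    exact ih (k := fun p => (fderiv ℝ k p).comp (ContinuousLinearMap.inl ℝ E ℝ))
      ((hk.fderiv_right le_rfl).clm_comp contDiff_const)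

/-! ### Radial regularity at the origin -/

/-- The average of `K` over the segment from `0` to `s`. -/
def segmentAverage (K : ℝ → ℝ) (s : ℝ) : ℝ := ∫ τ in (0 : ℝ)..1, K (τ * s)

theorem continuous_segmentAverage {K : ℝ → ℝ} (hK : Continuous K) :
    Continuous (segmentAverage K) :=
  intervalIntegral.continuous_parametric_intervalIntegral_of_continuous'
    (f := fun s τ => K (τ * s)) (by fun_prop) 0 1

theorem mul_segmentAverage (K : ℝ → ℝ) (s : ℝ) :
    s * segmentAverage K s = ∫ σ in (0 : ℝ)..s, K σ := by
  simp [segmentAverage]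

/-- The substitution `τ = σ²` expresses the average through `z ↦ K (‖z‖ ^ 2)` at the points `σ z`,
so regularity of that function suffices and none of `K` at `0` is needed. -/
theorem segmentAverage_norm_sq {K : ℝ → ℝ} (hK : Continuous K) (z : ℂ) :
    segmentAverage K (‖z‖ ^ 2) = ∫ σ in (0 : ℝ)..1, K (‖(σ : ℂ) * z‖ ^ 2) * (2 * σ) := by
  have h := intervalIntegral.integral_comp_mul_deriv (a := 0) (b := 1)
    (f := fun σ : ℝ => σ ^ 2) (f' := fun σ => 2 * σ) (g := fun τ => K (τ * ‖z‖ ^ 2))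
    (fun x _ => by simpa using hasDerivAt_pow 2 x) (by fun_prop) (by fun_prop)
  simp only [Function.comp_def] at h
  rw [segmentAverage]
  simpa [mul_pow] using h.symm

/-- If `K (|z|²)` is `C^n` then so is its radial average. -/
theorem contDiff_segmentAverage_norm_sq {K : ℝ → ℝ} (hK : Continuous K) (n : ℕ)
    (h : ContDiff ℝ n fun z : ℂ => K (‖z‖ ^ 2)) :
    ContDiff ℝ n fun z : ℂ => segmentAverage K (‖z‖ ^ 2) := by
  simp_rw [segmentAverage_norm_sq hK]
  refine contDiff_intervalIntegral (E := ℂ) (F := ℝ) 0 1 n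
    (k := fun p : ℂ × ℝ => K (‖(p.2 : ℂ) * p.1‖ ^ 2) * (2 * p.2)) ?_
  have hm : ContDiff ℝ n fun p : ℂ × ℝ => (p.2 : ℂ) * p.1 :=
    (Complex.ofRealCLM.contDiff.comp contDiff_snd).mul contDiff_fst
  exact (h.comp hm).mul (contDiff_const.mul contDiff_snd)

/-- A solution of `(s U')' = K` on `(0, ∞)` with a finite limit at `0` extends to a `C¹` function
on the line. -/
theorem eq_primitive_of_singular_ode {U P K : ℝ → ℝ} {L : ℝ} (hK : Continuous K)
    (hU : ∀ s, 0 < s → HasDerivAt U (P s / s) s) (hP : ∀ s, 0 < s → HasDerivAt P (K s) s)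
    (hL : Tendsto U (𝓝[>] 0) (𝓝 L)) :
    (∀ s, 0 < s → P s = s * segmentAverage K s) ∧
      ∀ s, 0 < s → U s = L + ∫ σ in (0 : ℝ)..s, segmentAverage K σ := by
  have hG := continuous_segmentAverage hK
  have const {V : ℝ → ℝ} (hV : ∀ s, 0 < s → HasDerivAt V 0 s) :
      ∀ s, 0 < s → V s = V 1 := fun s hs =>
    isOpen_Ioi.is_const_of_deriv_eq_zero isPreconnected_Ioi
      (fun x hx => (hV x hx).differentiableAt.differentiableWithinAt)
      (fun x hx => (hV x hx).deriv) (Set.mem_Ioi.2 hs) (Set.mem_Ioi.2 one_pos)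
  obtain ⟨c, hc⟩ : ∃ c, ∀ s, 0 < s → P s - s * segmentAverage K s = c := by
    refine ⟨_, const fun s hs => ?_⟩
    simp_rw [mul_segmentAverage]
    exact ((hP s hs).sub (hK.integral_hasStrictDerivAt 0 s).hasDerivAt).congr_deriv (sub_self _)
  -- Dividing `P = s * segmentAverage K s + c` by `s` and integrating, `c` becomes the coefficient
  -- of the singular solution `log s`.
  obtain ⟨d, hd⟩ : ∃ d, ∀ s, 0 < s →
      U s - c * Real.log s - ∫ σ in (0 : ℝ)..s, segmentAverage K σ = d := by
    refine ⟨_, const fun s hs => ?_⟩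
    have := ((hU s hs).sub ((Real.hasDerivAt_log hs.ne').const_mul c)).sub
      (hG.integral_hasStrictDerivAt 0 s).hasDerivAt
    refine this.congr_deriv ?_
    rw [← hc s hs]
    field_simp
    ring
  have hI : Tendsto (fun s => ∫ σ in (0 : ℝ)..s, segmentAverage K σ) (𝓝[>] 0) (𝓝 0) := by
    have : Continuous fun s => ∫ σ in (0 : ℝ)..s, segmentAverage K σ :=
      intervalIntegral.continuous_primitive (fun a b => hG.intervalIntegrable a b) 0
    simpa using (this.tendsto 0).mono_left nhdsWithin_le_nhds
  have hlog : Tendsto (fun s => c * Real.log s) (𝓝[>] 0) (𝓝 (L - 0 - d)) := by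
    refine ((hL.sub hI).sub_const d).congr' ?_
    filter_upwards [self_mem_nhdsWithin] with s hs
    rw [← hd s hs]; ring
  -- `U` has a finite limit while `log` is unbounded at `0`.
  have hc0 : c = 0 := by
    by_contra hne
    have h1 : Tendsto Real.log (𝓝[>] 0) (𝓝 (c⁻¹ * (L - 0 - d))) :=
      (hlog.const_mul c⁻¹).congr fun s => by field_simp
    exact not_tendsto_nhds_of_tendsto_atBot Real.tendsto_log_nhdsGT_zero _ h1
  subst hc0
  have hdL : L - 0 - d = 0 := by
    refine tendsto_nhds_unique hlog ?_
    simp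
  refine ⟨fun s hs => by linarith [hc s hs], fun s hs => ?_⟩
  have := hd s hs
  linarith

/-- Elliptic regularity for radial solutions of `(s U')' = F(s, U)`, `s = |z|²`: a solution with a
finite limit at `0` is smooth on the plane as a function of `z`. -/
theorem exists_smooth_extension {U P : ℝ → ℝ} {L : ℝ} {F : ℝ × ℝ → ℝ} (hF : ContDiff ℝ ∞ F)
    (hU : ∀ s, 0 < s → HasDerivAt U (P s / s) s)
    (hP : ∀ s, 0 < s → HasDerivAt P (F (s, U s)) s) (hL : Tendsto U (𝓝[>] 0) (𝓝 L)) :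
    ∃ (w G : ℂ → ℝ), ContDiff ℝ ∞ w ∧ ContDiff ℝ ∞ G ∧
      (∀ z, HasFDerivAt w (G z • (2 • innerSL ℝ z)) z) ∧
      ∀ z, z ≠ 0 → w z = U (‖z‖ ^ 2) ∧ P (‖z‖ ^ 2) = ‖z‖ ^ 2 * G z := by
  -- Extending by the constant `L` makes `K` continuous on the whole line, so the fundamental
  -- theorem of calculus is two-sided at `0`.
  set V : ℝ → ℝ := fun s => if 0 < s then U s else L with hVdef
  have hVpos : ∀ s, 0 < s → V s = U s := fun s hs => if_pos hs
  have hV : Continuous V := by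
    rw [continuous_iff_continuousAt]
    intro s
    rcases lt_trichotomy s 0 with hs | rfl | hs
    · refine (continuousAt_const (y := L)).congr ?_
      filter_upwards [eventually_lt_nhds hs] with x hx
      exact (if_neg hx.not_gt).symm
    · rw [continuousAt_iff_continuous_left'_right']
      constructor
      · refine (continuousWithinAt_const (b := L)).congr (fun x hx => if_neg (not_lt.2 hx.le)) ?_
        exact if_neg (lt_irrefl 0)
      · have : V 0 = L := by simp [hVdef]
        rw [ContinuousWithinAt, this]
        refine hL.congr' ?_
        filter_upwards [self_mem_nhdsWithin] with x hx
        exact (hVpos x hx).symm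
    · refine (hU s hs).continuousAt.congr ?_
      filter_upwards [eventually_gt_nhds hs] with x hx
      exact (hVpos x hx).symm
  set K : ℝ → ℝ := fun s => F (s, V s) with hKdef
  have hK : Continuous K := hF.continuous.comp (by fun_prop)
  obtain ⟨hP', hU'⟩ := eq_primitive_of_singular_ode (K := K) hK hU
    (fun s hs => by simpa only [hKdef, hVpos s hs] using hP s hs) hL
  set W : ℝ → ℝ := fun s => L + ∫ σ in (0 : ℝ)..s, segmentAverage K σ with hWdef
  -- Agreement on `s ≥ 0` is enough, as only `s = ‖z‖ ^ 2` is ever substituted.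
  have hVW : ∀ s, 0 ≤ s → V s = W s := by
    intro s hs
    rcases hs.eq_or_lt with rfl | hs
    · simp [hVdef, hWdef]
    · rw [hVpos s hs, hU' s hs]
  have hder : ∀ z : ℂ, HasFDerivAt (fun z : ℂ => W (‖z‖ ^ 2))
      (segmentAverage K (‖z‖ ^ 2) • (2 • innerSL ℝ z)) z := fun z =>
    (((continuous_segmentAverage hK).integral_hasStrictDerivAt 0 _).hasDerivAt.const_add
      L).comp_hasFDerivAt z (hasStrictFDerivAt_norm_sq z).hasFDerivAt
  -- Bootstrap: `W` of class `C^n` makes `F(s, W)` and hence its average `C^n`; that average times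
  -- `2⟨z, ·⟩` is the derivative of `W`, so `W` is `C^{n+1}`.
  have main : ∀ n : ℕ, ContDiff ℝ n (fun z : ℂ => W (‖z‖ ^ 2)) ∧
      ContDiff ℝ n fun z : ℂ => segmentAverage K (‖z‖ ^ 2) := by
    have step : ∀ n : ℕ, ContDiff ℝ n (fun z : ℂ => W (‖z‖ ^ 2)) →
        ContDiff ℝ n fun z : ℂ => segmentAverage K (‖z‖ ^ 2) := by
      intro n hn
      refine contDiff_segmentAverage_norm_sq hK n ?_
      have : (fun z : ℂ => K (‖z‖ ^ 2)) = fun z => F (‖z‖ ^ 2, W (‖z‖ ^ 2)) := by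
        funext z
        simp only [hKdef, hVW _ (sq_nonneg ‖z‖)]
      rw [this]
      exact (hF.of_le (by exact_mod_cast le_top)).comp ((contDiff_norm_sq ℝ).prodMk hn)
    intro n
    induction n with
    | zero =>
      have : ContDiff ℝ (0 : ℕ) (fun z : ℂ => W (‖z‖ ^ 2)) := by
        rw [Nat.cast_zero, contDiff_zero, continuous_iff_continuousAt]
        exact fun z => (hder z).continuousAt
      exact ⟨this, step 0 this⟩
    | succ n ih =>
      have : ContDiff ℝ (n + 1 : ℕ) (fun z : ℂ => W (‖z‖ ^ 2)) := by
        rw [Nat.cast_succ]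
        refine contDiff_succ_iff_fderiv.2 ⟨fun z => (hder z).differentiableAt, by simp, ?_⟩
        rw [show fderiv ℝ (fun z : ℂ => W (‖z‖ ^ 2)) = _ from funext fun z => (hder z).fderiv]
        simp_rw [two_nsmul]
        exact ih.2.smul ((innerSL ℝ (E := ℂ)).contDiff.add (innerSL ℝ (E := ℂ)).contDiff)
      exact ⟨this, step _ this⟩
  refine ⟨fun z => W (‖z‖ ^ 2), fun z => segmentAverage K (‖z‖ ^ 2),
    contDiff_infty.2 fun n => (main n).1, contDiff_infty.2 fun n => (main n).2, hder,
    fun z hz => ?_⟩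
  have hz' : 0 < ‖z‖ ^ 2 := by positivity
  exact ⟨(hU' _ hz').symm, hP' _ hz'⟩

/-! ### The action of real diagonal gauges -/

/-- The coefficient `∂w/∂z` of a real valued function. -/
def dzReal (w : ℂ → ℝ) (z : ℂ) : ℂ :=
  ((fderiv ℝ w z 1 : ℂ) - Complex.I * (fderiv ℝ w z Complex.I : ℂ)) / 2

/-- The gauge transformation `exp(diag(v, -v))`. -/
def expGauge (v : ℂ → ℝ) (z : ℂ) : M2 :=
  !![((Real.exp (v z) : ℝ) : ℂ), 0; 0, ((Real.exp (-v z) : ℝ) : ℂ)]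

/-- The transform of the base pair by `exp(diag(w, -w))`. -/
def expPair (w : ℂ → ℝ) : Pair where
  Az z := (-dzReal w z) • !![1, 0; 0, -1]
  Azbar z := (starRingEnd ℂ (dzReal w z)) • !![1, 0; 0, -1]
  phi z := !![0, ((Real.exp (-2 * w z) : ℝ) : ℂ); z * ((Real.exp (2 * w z) : ℝ) : ℂ), 0]

theorem expPair_zero : expPair (fun _ => 0) = basePair := by
  ext z i j <;> fin_cases i <;> fin_cases j <;> simp [expPair, basePair, dzReal]

theorem contDiffOn_ofReal {U : Set ℂ} {w : ℂ → ℝ} (hw : ContDiffOn ℝ ∞ w U) :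
    ContDiffOn ℝ ∞ (fun z => (w z : ℂ)) U :=
  Complex.ofRealCLM.contDiff.comp_contDiffOn hw

theorem contDiffOn_dzReal {U : Set ℂ} (hUo : IsOpen U) {w : ℂ → ℝ} (hw : ContDiffOn ℝ ∞ w U) :
    ContDiffOn ℝ ∞ (dzReal w) U := by
  have h := hw.fderiv_of_isOpen hUo (m := ∞) (by simp)
  have h' (a : ℂ) : ContDiffOn ℝ ∞ (fun z => ((fderiv ℝ w z a : ℝ) : ℂ)) U :=
    contDiffOn_ofReal (h.clm_apply contDiffOn_const)
  exact ((h' 1).sub (contDiffOn_const.mul (h' Complex.I))).div_const 2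

theorem isConfiguration_expPair {U : Set ℂ} (hUo : IsOpen U) {w : ℂ → ℝ}
    (hw : ContDiffOn ℝ ∞ w U) : IsConfiguration U (expPair w) where
  smooth_Az := by
    have h := contDiffOn_dzReal hUo hw
    intro i j
    fin_cases i <;> fin_cases j <;> simp [expPair, contDiffOn_const, h, h.neg]
  smooth_Azbar := by
    have h : ContDiffOn ℝ ∞ (fun z => starRingEnd ℂ (dzReal w z)) U :=
      Complex.conjCLE.contDiff.comp_contDiffOn (contDiffOn_dzReal hUo hw)
    intro i j
    fin_cases i <;> fin_cases j <;> simp [expPair, contDiffOn_const, h, h.neg]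
  smooth_phi := by
    have h1 := contDiffOn_ofReal (contDiffOn_const (c := (-2 : ℝ)) |>.mul hw).exp
    have h2 := contDiffOn_id.mul (contDiffOn_ofReal (contDiffOn_const (c := (2 : ℝ)) |>.mul hw).exp)
    intro i j
    fin_cases i <;> fin_cases j <;>
      first
      | exact contDiffOn_const
      | exact h1
      | exact h2
  unitary z _ := by
    ext i j
    fin_cases i <;> fin_cases j <;> simp [expPair]
  trace_Az z _ := by simp [expPair, Matrix.trace_fin_two]
  trace_phi z _ := by simp [expPair, Matrix.trace_fin_two]

theorem isComplexGauge_expGauge {U : Set ℂ} {v : ℂ → ℝ} (hv : ContDiffOn ℝ ∞ v U) :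
    IsComplexGauge U (expGauge v) where
  smooth := by
    intro i j
    fin_cases i <;> fin_cases j <;>
      first
      | exact contDiffOn_const
      | exact contDiffOn_ofReal hv.exp
      | exact contDiffOn_ofReal hv.neg.exp
  det_eq_one z _ := by
    rw [expGauge, Matrix.det_fin_two_of, ← Complex.ofReal_mul, ← Real.exp_add]
    simp

theorem expGauge_conjTranspose (v : ℂ → ℝ) (z : ℂ) : (expGauge v z)ᴴ = expGauge v z := by
  ext i j
  fin_cases i <;> fin_cases j <;> simp [expGauge, -Complex.ofReal_exp]

theorem expGauge_mul_neg (v : ℂ → ℝ) (z : ℂ) : expGauge v z * expGauge (-v) z = 1 := by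
  ext i j
  fin_cases i <;> fin_cases j <;> simp [expGauge, ← Complex.exp_add]

theorem expGauge_neg_mul (v : ℂ → ℝ) (z : ℂ) : expGauge (-v) z * expGauge v z = 1 := by
  simpa using expGauge_mul_neg (-v) z

theorem expGauge_inv (v : ℂ → ℝ) (z : ℂ) : (expGauge v z)⁻¹ = expGauge (-v) z :=
  Matrix.inv_eq_right_inv (expGauge_mul_neg v z)

theorem expGauge_mul_comm (v : ℂ → ℝ) (z : ℂ) :
    expGauge v z * !![1, 0; 0, -1] = !![1, 0; 0, -1] * expGauge v z := by
  ext i j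
  fin_cases i <;> fin_cases j <;> simp [expGauge]

theorem fderiv_ofReal_exp {v : ℂ → ℝ} {z : ℂ} (hv : DifferentiableAt ℝ v z) (a : ℂ) :
    fderiv ℝ (fun w => ((Real.exp (v w) : ℝ) : ℂ)) z a = Real.exp (v z) * (fderiv ℝ v z a : ℂ) := by
  have := (Complex.ofRealCLM.hasFDerivAt (x := Real.exp (v z))).comp z hv.hasFDerivAt.exp
  rw [show (fun w => ((Real.exp (v w) : ℝ) : ℂ)) =
    Complex.ofRealCLM ∘ fun w => Real.exp (v w) from rfl, this.fderiv]
  simp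

theorem dzReal_neg (v : ℂ → ℝ) (z : ℂ) : dzReal (-v) z = -dzReal v z := by
  simp [dzReal, fderiv_neg]
  ring

theorem dzReal_add {v w : ℂ → ℝ} {z : ℂ} (hv : DifferentiableAt ℝ v z)
    (hw : DifferentiableAt ℝ w z) : dzReal (v + w) z = dzReal v z + dzReal w z := by
  simp [dzReal, fderiv_add hv hw]
  ring

theorem dz_expGauge {v : ℂ → ℝ} {z : ℂ} (hv : DifferentiableAt ℝ v z) :
    dz (expGauge v) z = dzReal v z • (expGauge v z * !![1, 0; 0, -1]) := by
  have h1 := fderiv_ofReal_exp hv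
  have h2 := fderiv_ofReal_exp hv.neg
  simp only [Pi.neg_apply, fderiv_neg] at h2
  ext i j
  fin_cases i <;> fin_cases j <;>
    simp [dz, expGauge, dzReal, h1, h2, -Complex.ofReal_exp] <;>
    ring

theorem dzbar_expGauge {v : ℂ → ℝ} {z : ℂ} (hv : DifferentiableAt ℝ v z) :
    dzbar (expGauge v) z =
      starRingEnd ℂ (dzReal v z) • (expGauge v z * !![1, 0; 0, -1]) := by
  have h1 := fderiv_ofReal_exp hv
  have h2 := fderiv_ofReal_exp hv.neg
  simp only [Pi.neg_apply, fderiv_neg] at h2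
  ext i j
  fin_cases i <;> fin_cases j <;>
    simp [dzbar, expGauge, dzReal, h1, h2, map_ofNat, -Complex.ofReal_exp] <;>
    ring

/-- Diagonal matrices commute, so conjugation fixes the connection coefficients and only the
logarithmic derivative of the gauge is added; on `phi` conjugation multiplies the off-diagonal
entries by `e^{∓2v}`. -/
theorem gaugeEquivalentVia_expGauge {U : Set ℂ} (hUo : IsOpen U) {w v : ℂ → ℝ}
    (hw : ContDiffOn ℝ ∞ w U) (hv : ContDiffOn ℝ ∞ v U) :
    GaugeEquivalentVia U (expGauge v) (expPair w) (expPair (w + v)) where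
  left := isConfiguration_expPair hUo hw
  right := isConfiguration_expPair hUo (hw.add hv)
  isGauge := isComplexGauge_expGauge hv
  eqOn := by
    have hd {w : ℂ → ℝ} (hw : ContDiffOn ℝ ∞ w U) {z : ℂ} (hz : z ∈ U) :
        DifferentiableAt ℝ w z :=
      (hw.differentiableOn (by simp)).differentiableAt (hUo.mem_nhds hz)
    refine ⟨fun z hz => ?_, fun z hz => ?_, fun z hz => ?_⟩
    · have h : (fun w => ((expGauge v w)ᴴ)⁻¹) = expGauge (-v) := by
        funext w
        rw [expGauge_conjTranspose, expGauge_inv]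
      simp only [Pair.gauge]
      rw [h, dz_expGauge (hd hv hz).neg, dzReal_neg, expGauge_conjTranspose, expGauge_inv]
      simp only [expPair]
      rw [dzReal_add (hd hw hz) (hd hv hz), Matrix.mul_smul, Matrix.smul_mul, Matrix.mul_smul,
        expGauge_mul_comm, Matrix.mul_assoc, ← Matrix.mul_assoc (expGauge v z),
        expGauge_mul_neg, Matrix.mul_one, Matrix.one_mul, ← add_smul, neg_add]
    · simp only [Pair.gauge]
      rw [dzbar_expGauge (hd hv hz), expGauge_inv]
      simp only [expPair]
      rw [dzReal_add (hd hw hz) (hd hv hz), Matrix.mul_smul, Matrix.smul_mul, Matrix.mul_smul,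
        expGauge_mul_comm, Matrix.mul_assoc, ← Matrix.mul_assoc (expGauge (-v) z),
        expGauge_neg_mul, Matrix.mul_one, Matrix.one_mul, map_add, add_smul]
    · have h1 : Real.exp (-2 * (w + v) z) =
          Real.exp (-v z) * Real.exp (-2 * w z) * Real.exp (-v z) := by
        rw [← Real.exp_add, ← Real.exp_add, Pi.add_apply]
        ring_nf
      have h2 : Real.exp (2 * (w + v) z) = Real.exp (v z) * Real.exp (2 * w z) * Real.exp (v z) := by
        rw [← Real.exp_add, ← Real.exp_add, Pi.add_apply]
        ring_nf
      simp only [Pair.gauge, expGauge_inv, expPair, h1, h2]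
      ext i j
      fin_cases i <;> fin_cases j <;> simp [expGauge, -Complex.ofReal_exp]
      ring

/-- Openness of `U` is what lets equality on `U` pass to the derivatives in the gauge action. -/
theorem GaugeEquivalentVia.congr {U : Set ℂ} (hUo : IsOpen U) {g g' : ℂ → M2} {p q q' : Pair}
    (h : GaugeEquivalentVia U g p q) (hg : Set.EqOn g' g U) (hq : Pair.EqOn U q q') :
    GaugeEquivalentVia U g' p q' where
  left := h.left
  right :=
    { smooth_Az := fun i j => (h.right.smooth_Az i j).congr fun z hz => by rw [← hq.1 hz]
      smooth_Azbar := fun i j => (h.right.smooth_Azbar i j).congr fun z hz => by rw [← hq.2.1 hz]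
      smooth_phi := fun i j => (h.right.smooth_phi i j).congr fun z hz => by rw [← hq.2.2 hz]
      unitary := fun z hz => by rw [← hq.1 hz, ← hq.2.1 hz, h.right.unitary z hz]
      trace_Az := fun z hz => by rw [← hq.1 hz, h.right.trace_Az z hz]
      trace_phi := fun z hz => by rw [← hq.2.2 hz, h.right.trace_phi z hz] }
  isGauge :=
    { smooth := fun i j => (h.isGauge.smooth i j).congr fun z hz => by rw [hg hz]
      det_eq_one := fun z hz => by rw [hg hz, h.isGauge.det_eq_one z hz] }
  eqOn := by
    have hev (z : ℂ) (hz : z ∈ U) (F : M2 → M2) (i j : Fin 2) :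
        (fun w => F (g' w) i j) =ᶠ[𝓝 z] fun w => F (g w) i j := by
      filter_upwards [hUo.mem_nhds hz] with w hw
      rw [hg hw]
    refine ⟨fun z hz => ?_, fun z hz => ?_, fun z hz => ?_⟩
    · rw [← hq.1 hz, ← h.eqOn.1 hz]
      simp only [Pair.gauge, dz, hg hz, (hev z hz (fun m => (mᴴ)⁻¹) _ _).fderiv_eq]
    · rw [← hq.2.1 hz, ← h.eqOn.2.1 hz]
      simp only [Pair.gauge, dzbar, hg hz, (hev z hz (fun m => m) _ _).fderiv_eq]
    · rw [← hq.2.2 hz, ← h.eqOn.2.2 hz]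
      simp only [Pair.gauge, hg hz]

/-- Uniqueness of limits identifies the value chosen by `limUnder`, so no limit at `0` has to be
computed once a continuous candidate is known. -/
theorem extendToZero_eq {m n : ℂ → M2} (hn : ContinuousAt n 0) (h : ∀ z, z ≠ 0 → m z = n z) :
    extendToZero m = n := by
  have hlim : Tendsto m (𝓝[≠] 0) (𝓝 (n 0)) := by
    refine (hn.tendsto.mono_left nhdsWithin_le_nhds).congr' ?_
    filter_upwards [self_mem_nhdsWithin] with z hz using (h z hz).symm
  funext z
  rcases eq_or_ne z 0 with rfl | hz
  · rw [extendToZero, Function.update_self, hlim.limUnder_eq]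
  · rw [extendToZero, Function.update_of_ne hz, h z hz]

theorem SmoothOn.continuous {m : ℂ → M2} (h : SmoothOn Set.univ m) : Continuous m :=
  continuous_matrix fun i j => (contDiffOn_univ.1 (h i j)).continuous

/-! ### The limiting solution on the punctured disc -/

theorem limitingFiducial_gaugeEquivalentVia (R : ℝ) :
    GaugeEquivalentVia (Metric.ball (0 : ℂ) R \ {0}) limitingGauge basePair limitingFiducial := by
  set U : Set ℂ := Metric.ball (0 : ℂ) R \ {0}
  have hUo : IsOpen U := Metric.isOpen_ball.sdiff isClosed_singleton
  have hne : ∀ z ∈ U, z ≠ 0 := fun z hz => hz.2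
  set v : ℂ → ℝ := fun z => -(1 / 8) * Real.log (‖z‖ ^ 2) with hvdef
  have hv : ContDiffOn ℝ ∞ v U := by
    refine contDiffOn_const.mul ((contDiff_norm_sq ℝ).contDiffOn.log fun z hz => ?_)
    have := hne z hz
    positivity
  have hv' : ∀ z, v z = -(1 / 4) * Real.log ‖z‖ := by
    intro z
    rw [hvdef]
    simp only [Real.log_pow]
    push_cast
    ring
  -- This is `∂/∂z` of `-(1/8) log (z z̄)`.
  have hder : ∀ z ∈ U, dzReal v z = -(1 / 8 / z) := by
    intro z hz
    have h0 := hne z hz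
    have hn : ‖z‖ ^ 2 ≠ 0 := by positivity
    have := ((hasStrictFDerivAt_norm_sq z).hasFDerivAt.log hn).const_mul (-(1 / 8))
    rw [dzReal, this.fderiv]
    have h1 : ((‖z‖ ^ 2 : ℝ) : ℂ) = z * starRingEnd ℂ z := by
      rw [Complex.mul_conj, Complex.normSq_eq_norm_sq]
    have h2 : starRingEnd ℂ z = z.re - Complex.I * z.im := by
      apply Complex.ext <;> simp
    have h3 : starRingEnd ℂ z ≠ 0 := by simpa using h0
    simp only [smul_apply, smul_eq_mul, innerSL_apply_apply,
      Complex.inner, nsmul_eq_mul, Complex.ofReal_mul, Complex.ofReal_inv, h1]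
    simp
    field_simp
    rw [h2]
    ring
  have h := gaugeEquivalentVia_expGauge hUo (w := fun _ => 0) contDiffOn_const hv
  rw [expPair_zero, show (fun _ : ℂ => (0 : ℝ)) + v = v from zero_add v] at h
  refine h.congr hUo (fun z hz => ?_) ⟨fun z hz => ?_, fun z hz => ?_, fun z hz => ?_⟩
  · have h0 : 0 < ‖z‖ := norm_pos_iff.2 (hne z hz)
    rw [limitingGauge, expGauge, Real.rpow_def_of_pos h0, Real.rpow_def_of_pos h0, hv' z]
    ring_nf
  · simp only [expPair, limitingFiducial, hder z hz, neg_neg]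
  · simp only [expPair, limitingFiducial, hder z hz]
    simp [map_ofNat]
  · have h0 : 0 < ‖z‖ := norm_pos_iff.2 (hne z hz)
    have h1 : Real.exp (-2 * v z) = √‖z‖ := by
      rw [Real.sqrt_eq_rpow, Real.rpow_def_of_pos h0, hv' z]
      ring_nf
    have h2 : Real.exp (2 * v z) = (√‖z‖)⁻¹ := by
      rw [← h1, ← Real.exp_neg]
      ring_nf
    simp only [expPair, limitingFiducial, h1, h2, Complex.ofReal_inv, div_eq_mul_inv]

/-! ### The Painlevé equation in the variable `s = r²` -/

/-- The function `u_t` in the variable `s = r²`. -/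
def uSq (ψ : ℝ → ℝ) (t s : ℝ) : ℝ :=
  -(1 / 8) * Real.log s - 1 / 2 * ψ (8 / 3 * t * s ^ (3 / 4 : ℝ))

/-- The function `s ∂_s u_t` in the variable `s = r²`. -/
def uSqFlux (ψ : ℝ → ℝ) (t s : ℝ) : ℝ :=
  -(1 / 8) - 3 / 8 * ((8 / 3 * t * s ^ (3 / 4 : ℝ)) * deriv ψ (8 / 3 * t * s ^ (3 / 4 : ℝ)))

theorem sq_rpow_three_quarters {r : ℝ} (hr : 0 ≤ r) :
    (r ^ 2) ^ (3 / 4 : ℝ) = r ^ (3 / 2 : ℝ) := by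
  rw [← Real.rpow_natCast, ← Real.rpow_mul hr]
  norm_num

theorem uSq_sq (ψ : ℝ → ℝ) (t : ℝ) {r : ℝ} (hr : 0 < r) : uSq ψ t (r ^ 2) = u ψ t r := by
  rw [uSq, u, h, sq_rpow_three_quarters hr.le, Real.log_pow]
  push_cast
  ring

/-- With `ρ = c s^p` the derivative is kept as `p ρ / s`, so that the chain rule turns `s d/ds` into
`p ρ d/dρ`. -/
theorem hasDerivAt_scaled_rpow (c p : ℝ) {s : ℝ} (hs : 0 < s) :
    HasDerivAt (fun s => c * s ^ p) (p * (c * s ^ p) / s) s := by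
  refine ((Real.hasDerivAt_rpow_const (p := p) (Or.inl hs.ne')).const_mul c).congr_deriv ?_
  rw [Real.rpow_sub_one hs.ne']
  ring

namespace IsPainleveFunction

theorem hasDerivAt {ψ : ℝ → ℝ} (hψ : IsPainleveFunction ψ)
    {ρ : ℝ} (hρ : 0 < ρ) : HasDerivAt ψ (deriv ψ ρ) ρ :=
  ((hψ.contDiffOn.differentiableOn (by simp)).differentiableAt (Ioi_mem_nhds hρ)).hasDerivAt

theorem hasDerivAt_mul_deriv {ψ : ℝ → ℝ} (hψ : IsPainleveFunction ψ)
    {ρ : ℝ} (hρ : 0 < ρ) :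
    HasDerivAt (fun s => s * deriv ψ s) (1 / 2 * ρ * Real.sinh (2 * ψ ρ)) ρ := by
  have h1 : DifferentiableAt ℝ (deriv ψ) ρ :=
    ((hψ.contDiffOn.deriv_of_isOpen (m := 1) isOpen_Ioi (by norm_num)).differentiableOn
      (by simp)).differentiableAt (Ioi_mem_nhds hρ)
  have h2 := (differentiableAt_id.mul h1).hasDerivAt
  refine HasDerivAt.congr_deriv (f := fun s => s * deriv ψ s) h2 ?_
  refine mul_left_cancel₀ hρ.ne' ((hψ.equation ρ hρ).trans ?_)
  ring

/-- Since `r ∂_r = 2 s ∂_s`, both sides are `-(1/2) r ∂_r u_t`. -/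
theorem f_eq {ψ : ℝ → ℝ} (hψ : IsPainleveFunction ψ)
    {t r : ℝ} (ht : 0 < t) (hr : 0 < r) : f ψ t r = -uSqFlux ψ t (r ^ 2) := by
  have hρ : 0 < 8 / 3 * t * r ^ (3 / 2 : ℝ) := by positivity
  have hd : HasDerivAt (h ψ t) _ r :=
    (hψ.hasDerivAt hρ).comp r (hasDerivAt_scaled_rpow (8 / 3 * t) (3 / 2) hr)
  rw [f, hd.deriv, uSqFlux, sq_rpow_three_quarters hr.le]
  field_simp
  ring

theorem hasDerivAt_uSq {ψ : ℝ → ℝ} (hψ : IsPainleveFunction ψ)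
    {t s : ℝ} (ht : 0 < t) (hs : 0 < s) :
    HasDerivAt (uSq ψ t) (uSqFlux ψ t s / s) s := by
  have hρ : 0 < 8 / 3 * t * s ^ (3 / 4 : ℝ) := by positivity
  refine (((Real.hasDerivAt_log hs.ne').const_mul (-(1 / 8))).sub
    (((hψ.hasDerivAt hρ).comp s
      (hasDerivAt_scaled_rpow (8 / 3 * t) (3 / 4) hs)).const_mul (1 / 2))).congr_deriv ?_
  rw [uSqFlux]
  field_simp
  ring

/-- The fractional powers cancel: `ρ² = (64/9) t² s^{3/2}`, while `e^{±2ψ} = s^{∓1/2} e^{∓4u}`. -/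
theorem hasDerivAt_uSqFlux {ψ : ℝ → ℝ} (hψ : IsPainleveFunction ψ)
    {t s : ℝ} (ht : 0 < t) (hs : 0 < s) :
    HasDerivAt (uSqFlux ψ t)
      (t ^ 2 / 2 * (s * Real.exp (4 * uSq ψ t s) - Real.exp (-4 * uSq ψ t s))) s := by
  have hρ : 0 < 8 / 3 * t * s ^ (3 / 4 : ℝ) := by positivity
  have hd := (((hψ.hasDerivAt_mul_deriv hρ).comp s
    (hasDerivAt_scaled_rpow (8 / 3 * t) (3 / 4) hs)).const_mul (3 / 8)).const_sub (-(1 / 8))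
  refine HasDerivAt.congr_deriv (f := uSqFlux ψ t) hd ?_
  set q := s ^ (1 / 2 : ℝ) with hq
  have hq0 : 0 < q := by positivity
  have hqs : q * q = s := by
    rw [hq, ← Real.rpow_add hs]
    norm_num
  have hqe : q = Real.exp (1 / 2 * Real.log s) := by
    rw [hq, Real.rpow_def_of_pos hs, mul_comm]
  have h34 : s ^ (3 / 4 : ℝ) * s ^ (3 / 4 : ℝ) = s * q := by
    rw [hq, ← Real.rpow_add hs, ← Real.rpow_one_add' hs.le (by norm_num)]
    norm_num
  set ρ := 8 / 3 * t * s ^ (3 / 4 : ℝ) with hρdef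
  have hρ2 : ρ * ρ = 64 / 9 * t ^ 2 * (s * q) := by
    rw [← h34, hρdef]
    ring
  have e1 : Real.exp (4 * uSq ψ t s) = q⁻¹ * Real.exp (-(2 * ψ ρ)) := by
    rw [hqe, ← Real.exp_neg, ← Real.exp_add, uSq, ← hρdef]
    ring_nf
  have e2 : Real.exp (-4 * uSq ψ t s) = q * Real.exp (2 * ψ ρ) := by
    rw [hqe, ← Real.exp_add, uSq, ← hρdef]
    ring_nf
  rw [e1, e2, Real.sinh_eq]
  have : -(3 / 8 * (1 / 2 * ρ * ((Real.exp (2 * ψ ρ) - Real.exp (-(2 * ψ ρ))) / 2) *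
      (3 / 4 * ρ / s))) = -(9 / 128 * (ρ * ρ) / s *
        (Real.exp (2 * ψ ρ) - Real.exp (-(2 * ψ ρ)))) := by ring
  rw [this, hρ2, ← hqs]
  field_simp
  ring

/-- Near `0`, `-ψ/2` is `(1/6) log ρ` plus a convergent term, and `ρ ∝ s^{3/4}` makes this `(1/8)
log s`, cancelling the explicit logarithm. -/
theorem exists_tendsto_uSq {ψ : ℝ → ℝ} (hψ : IsPainleveFunction ψ)
    {t : ℝ} (ht : 0 < t) :
    ∃ L, Tendsto (uSq ψ t) (𝓝[>] 0) (𝓝 L) := by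
  obtain ⟨a, ha, hlim⟩ := hψ.at_zero
  have hρ : Tendsto (fun s : ℝ => 8 / 3 * t * s ^ (3 / 4 : ℝ)) (𝓝[>] 0) (𝓝[>] 0) := by
    refine tendsto_nhdsWithin_iff.2 ⟨?_, ?_⟩
    · have : ContinuousAt (fun s : ℝ => 8 / 3 * t * s ^ (3 / 4 : ℝ)) 0 :=
        (Real.continuousAt_rpow_const _ _ (Or.inr (by norm_num))).const_mul _
      simpa [ContinuousAt, Real.zero_rpow] using this.tendsto.mono_left nhdsWithin_le_nhds
    · filter_upwards [self_mem_nhdsWithin] with s hs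
      have : (0 : ℝ) < s := hs
      exact Set.mem_Ioi.2 (by positivity)
  have h1 := ((Real.continuousAt_log ha.ne').tendsto.comp (hlim.comp hρ)).const_mul (1 / 2)
  refine ⟨_, (h1.add_const (1 / 6 * Real.log (8 / 3 * t))).congr' ?_⟩
  filter_upwards [self_mem_nhdsWithin] with s hs
  have hs : (0 : ℝ) < s := hs
  have hρs : 0 < 8 / 3 * t * s ^ (3 / 4 : ℝ) := by positivity
  simp only [Function.comp_apply]
  rw [Real.log_mul (by positivity) (by positivity), Real.log_rpow hρs, Real.log_exp,
    Real.log_mul (by positivity) (by positivity), Real.log_rpow hs, uSq]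
  ring

/-- `u_t` is the restriction of a smooth function on the plane, and the fiducial solution is the
transform of the base pair by it. -/
theorem exists_fiducial_eq {ψ : ℝ → ℝ} (hψ : IsPainleveFunction ψ)
    {t : ℝ} (ht : 0 < t) :
    ∃ w : ℂ → ℝ, ContDiff ℝ ∞ w ∧ fiducialGauge ψ t = expGauge w ∧
      fiducial ψ t = expPair w := by
  obtain ⟨L, hL⟩ := hψ.exists_tendsto_uSq ht
  have hF : ContDiff ℝ ∞ fun p : ℝ × ℝ =>
      t ^ 2 / 2 * (p.1 * Real.exp (4 * p.2) - Real.exp (-4 * p.2)) := by fun_prop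
  obtain ⟨w, G, hw, hG, hder, heq⟩ := exists_smooth_extension hF
    (fun s hs => hψ.hasDerivAt_uSq ht hs) (fun s hs => hψ.hasDerivAt_uSqFlux ht hs) hL
  have hwu : ∀ z, z ≠ 0 → w z = u ψ t ‖z‖ := fun z hz => by
    rw [(heq z hz).1, uSq_sq ψ t (norm_pos_iff.2 hz)]
  have hfG : ∀ z, z ≠ 0 → (f ψ t ‖z‖ : ℂ) = -(z * starRingEnd ℂ z * G z) := fun z hz => by
    rw [hψ.f_eq ht (norm_pos_iff.2 hz), (heq z hz).2, Complex.mul_conj, Complex.normSq_eq_norm_sq]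
    push_cast
    ring
  -- The chain rule with `∂|z|²/∂z = z̄`. Together with `hfG` it turns the singular coefficient `f_t
  -- / z` into the smooth `-z̄ G`.
  have hdz : ∀ z, dzReal w z = starRingEnd ℂ z * G z := by
    intro z
    have h2 : starRingEnd ℂ z = z.re - Complex.I * z.im := by
      apply Complex.ext <;> simp
    rw [dzReal, (hder z).fderiv, h2]
    simp [Complex.inner]
    ring
  have hgauge := isComplexGauge_expGauge (U := Set.univ) hw.contDiffOn
  have hconf := isConfiguration_expPair isOpen_univ hw.contDiffOn
  refine ⟨w, hw, ?_, ?_⟩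
  · refine extendToZero_eq hgauge.smooth.continuous.continuousAt fun z hz => ?_
    rw [expGauge, hwu z hz]
  · refine Pair.ext ?_ ?_ ?_
    · refine extendToZero_eq hconf.smooth_Az.continuous.continuousAt fun z hz => ?_
      simp only [expPair]
      rw [hfG z hz, hdz z]
      congr 1
      field_simp
    · refine extendToZero_eq hconf.smooth_Azbar.continuous.continuousAt fun z hz => ?_
      have hz' : starRingEnd ℂ z ≠ 0 := by simpa using hz
      simp only [expPair]
      rw [hfG z hz, hdz z, map_mul, Complex.conj_conj, Complex.conj_ofReal]
      congr 1
      field_simp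
    · refine extendToZero_eq hconf.smooth_phi.continuous.continuousAt fun z hz => ?_
      have h0 : 0 < ‖z‖ := norm_pos_iff.2 hz
      have hsq : √‖z‖ = Real.exp (1 / 2 * Real.log ‖z‖) := by
        rw [Real.sqrt_eq_rpow, Real.rpow_def_of_pos h0, mul_comm]
      have h1 : √‖z‖ * Real.exp (h ψ t ‖z‖) = Real.exp (-2 * w z) := by
        rw [hwu z hz, hsq, ← Real.exp_add, u]
        ring_nf
      have h2 : √‖z‖ / ‖z‖ * Real.exp (-h ψ t ‖z‖) = Real.exp (2 * w z) := by
        nth_rewrite 2 [← Real.exp_log h0]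
        rw [hwu z hz, hsq, ← Real.exp_sub, ← Real.exp_add, u]
        ring_nf
      simp only [expPair]
      rw [h1, ← h2]
      push_cast
      congr 3
      ring_nf

end IsPainleveFunction

end Fiducial

end

theorem mainTheorem6 (R : ℝ) (hR : 0 < R) :
    (∀ ψ : ℝ → ℝ, Fiducial.IsPainleveFunction ψ →
      (∀ t : ℝ, 0 < t →
        Fiducial.GaugeEquivalentVia (Metric.ball (0 : ℂ) R) (Fiducial.fiducialGauge ψ t)
          Fiducial.basePair (Fiducial.fiducial ψ t)) ∧
      (∀ s t : ℝ, 0 < s → 0 < t →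
        Fiducial.GaugeEquivalent (Metric.ball (0 : ℂ) R)
          (Fiducial.fiducial ψ s) (Fiducial.fiducial ψ t))) ∧
    Fiducial.GaugeEquivalentVia (Metric.ball (0 : ℂ) R \ {0}) Fiducial.limitingGauge
      Fiducial.basePair Fiducial.limitingFiducial := by
  refine ⟨fun ψ hψ => ⟨fun t ht => ?_, fun s t hs ht => ?_⟩,
    Fiducial.limitingFiducial_gaugeEquivalentVia R⟩
  · obtain ⟨w, hw, hg, hp⟩ := hψ.exists_fiducial_eq ht
    have := Fiducial.gaugeEquivalentVia_expGauge (Metric.isOpen_ball (x := (0 : ℂ)) (ε := R))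
      (w := fun _ => 0) contDiffOn_const hw.contDiffOn
    rwa [Fiducial.expPair_zero, show (fun _ : ℂ => (0 : ℝ)) + w = w from zero_add w, ← hg, ← hp]
      at this
  · obtain ⟨w, hw, -, hp⟩ := hψ.exists_fiducial_eq hs
    obtain ⟨w', hw', -, hp'⟩ := hψ.exists_fiducial_eq ht
    -- Exponents add, so the gauge from `expPair w` to `expPair w'` has exponent `w' - w`.
    refine ⟨Fiducial.expGauge (w' - w), ?_⟩
    have := Fiducial.gaugeEquivalentVia_expGauge (Metric.isOpen_ball (x := (0 : ℂ)) (ε := R))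
      hw.contDiffOn (hw'.sub hw).contDiffOn
    rwa [show w + (fun z => w' z - w z) = w' from add_sub_cancel w w', ← hp, ← hp'] at this
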